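/- **Setting.** Let $X$, $Y$, $\partial X$ be complex Banach spaces with a continuous embedding $Y\hookrightarrow X$. Let $A:D(A)\to X$ be linear with $D(A)\subset Y$, let $R:D(A)\to\partial X$ be linear and surjective, let $B_1,B_2:Y\to\partial X$ and $B_4:\partial X\to\partial X$ be bounded linear operators. Assume that $\binom{A}{R}:D(A)\subset Y\to X\times\partial X$ is closed, and that $A_0:=A|_{\ker R}$ generates a cosine operator function with associated phase space $Y\times X$ (that is, $A_0$ generates a cosine operator function on $X$, and $\begin{pmatrix}0&I\\A_0&0\end{pmatrix}$ with domain $D(A_0)\times Y$ generates a strongly continuous group on $Y\times X$). On $Y\times X\times\partial X$ consider $$\mathcal A=\begin{pmatrix}0&I&0\\ A&0&0\\ B_1+B_4B_2&0&B_4\end{pmatrix},\qquad D(\mathcal A)=\{(u,v,y)\in D(A)\times Y\times\partial X:\ Ru=y\}.$$ A closed linear operator $T:D(T)\subset E\to E$ on a Banach space $E$ is called Fredholm if $\dim\ker T<\infty$ and $\operatorname{codim}\operatorname{ran}T<\infty$; then $\operatorname{ind}T:=\dim\ker T-\operatorname{codim}\operatorname{ran}T$. The essential spectrum $\sigma_{\rm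 ess}(T)$ is the set of all $\mu\in\mathbb C$ such that $T-\mu$ is not Fredholm. **Proposition 4.1.** Assume that there is a Banach space $Z$ containing $D(A)$ and compactly embedded in $Y$, and that the embedding $Y\hookrightarrow X$ is compact. Then $$\sigma_{\rm ess}(\mathcal A)=\sigma_{\rm ess}(B_4)\qquad\text{and}\qquad \operatorname{ind}(\mathcal A-\mu)=\operatorname{ind}(B_4-\mu)\quad\text{for all }\mu\notin\sigma_{\rm ess}(B_4).$$ In particular, $\sigma_{\rm ess}(\mathcal A)=\emptyset$ if and only if $\partial X$ is finite dimensional. -/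

import Mathlib

open Topology Filter

/-- A strongly continuous one-parameter group `T` of bounded operators on `E`. -/
structure IsC0Group {E : Type*} [NormedAddCommGroup E] [NormedSpace ℂ E]
    (T : ℝ → E →L[ℂ] E) : Prop where
  map_zero : T 0 = ContinuousLinearMap.id ℂ E
  map_add : ∀ t s : ℝ, T (t + s) = (T t).comp (T s)
  strongly_continuous : ∀ x : E, Continuous fun t : ℝ => T t x

/-- `G` is the (infinitesimal) generator of a strongly continuous group: `x ∈ D(G)` and `G x = y`
exactly when `(T t x - x) / t → y` as `t → 0`. -/
def GeneratesC0Group {E : Type*} [NormedAddCommGroup E] [NormedSpace ℂ E]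
    (G : E →ₗ.[ℂ] E) : Prop :=
  ∃ T : ℝ → E →L[ℂ] E, IsC0Group T ∧
    ∀ x y : E, (x, y) ∈ G.graph ↔
      Tendsto (fun t : ℝ => (t : ℂ)⁻¹ • (T t x - x)) (𝓝[≠] 0) (𝓝 y)

/-- A (strongly continuous) cosine operator function `C` on `E`. -/
structure IsCosineFunction {E : Type*} [NormedAddCommGroup E] [NormedSpace ℂ E]
    (C : ℝ → E →L[ℂ] E) : Prop where
  map_zero : C 0 = ContinuousLinearMap.id ℂ E
  dalembert : ∀ t s : ℝ, C (t + s) + C (t - s) = (2 : ℂ) • (C t).comp (C s)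
  strongly_continuous : ∀ x : E, Continuous fun t : ℝ => C t x

/-- `G` is the generator of a cosine operator function: `x ∈ D(G)` and `G x = y`
exactly when `(2 / t²) (C t x - x) → y` as `t → 0`. -/
def GeneratesCosineFunction {E : Type*} [NormedAddCommGroup E] [NormedSpace ℂ E]
    (G : E →ₗ.[ℂ] E) : Prop :=
  ∃ C : ℝ → E →L[ℂ] E, IsCosineFunction C ∧
    ∀ x y : E, (x, y) ∈ G.graph ↔
      Tendsto (fun t : ℝ => (2 / (t : ℂ) ^ 2) • (C t x - x)) (𝓝[≠] 0) (𝓝 y)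

/-- For an embedding `ι : Y ↪ X`, the map that regards an element of `X` lying in (the copy
`range ι` of) `Y` as an element of `Y`, that is, `ι⁻¹` with domain `range ι`. -/
noncomputable def embeddingInverse {X Y : Type*} [NormedAddCommGroup X] [NormedSpace ℂ X]
    [NormedAddCommGroup Y] [NormedSpace ℂ Y] (ι : Y →L[ℂ] X) (hι : Function.Injective ι) :
    X →ₗ.[ℂ] Y where
  domain := LinearMap.range (ι : Y →ₗ[ℂ] X)
  toFun := ((LinearEquiv.ofInjective (ι : Y →ₗ[ℂ] X) hι).symm : _ →ₗ[ℂ] Y)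

/-- An operator `T` with domain in `Y ↪ X` and values in `X`, regarded as an operator on `X`. -/
noncomputable def operatorOn {X Y : Type*} [NormedAddCommGroup X] [NormedSpace ℂ X]
    [NormedAddCommGroup Y] [NormedSpace ℂ Y] (ι : Y →L[ℂ] X) (hι : Function.Injective ι)
    (T : Y →ₗ.[ℂ] X) : X →ₗ.[ℂ] X where
  domain := T.domain.map (ι : Y →ₗ[ℂ] X)
  toFun := T.toFun ∘ₗ
    ((Submodule.equivMapOfInjective (ι : Y →ₗ[ℂ] X) hι T.domain).symm : _ →ₗ[ℂ] T.domain)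

/-- The operator matrix `(0 I; T 0)` on `Y × X` with domain `D(T) × Y`, for an operator `T` with
domain in `Y ↪ X` and values in `X`. -/
noncomputable def reductionMatrix {X Y : Type*} [NormedAddCommGroup X] [NormedSpace ℂ X]
    [NormedAddCommGroup Y] [NormedSpace ℂ Y] (ι : Y →L[ℂ] X) (hι : Function.Injective ι)
    (T : Y →ₗ.[ℂ] X) : (Y × X) →ₗ.[ℂ] (Y × X) where
  domain := T.domain.prod (embeddingInverse ι hι).domain
  toFun :=
    { toFun := fun p => (embeddingInverse ι hι ⟨p.1.2, p.2.2⟩, T ⟨p.1.1, p.2.1⟩)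
      map_add' := fun p q => Prod.ext
        ((embeddingInverse ι hι).map_add ⟨p.1.2, p.2.2⟩ ⟨q.1.2, q.2.2⟩)
        (T.map_add ⟨p.1.1, p.2.1⟩ ⟨q.1.1, q.2.1⟩)
      map_smul' := fun c p => Prod.ext
        ((embeddingInverse ι hι).map_smul c ⟨p.1.2, p.2.2⟩)
        (T.map_smul c ⟨p.1.1, p.2.1⟩) }

/-- `T`, with domain in `Y ↪ X` and regarded as an operator on `X`, generates a cosine operator
function whose associated phase space is `Y × X`: the space `Y` is the one (unique up to
equivalence of norms) for which `(0 I; T 0)` with domain `D(T) × Y` generates a strongly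
continuous group on `Y × X`. -/
def GeneratesCosineWithPhaseSpace {X Y : Type*} [NormedAddCommGroup X] [NormedSpace ℂ X]
    [NormedAddCommGroup Y] [NormedSpace ℂ Y] (ι : Y →L[ℂ] X) (hι : Function.Injective ι)
    (T : Y →ₗ.[ℂ] X) : Prop :=
  GeneratesCosineFunction (operatorOn ι hι T) ∧ GeneratesC0Group (reductionMatrix ι hι T)

/-- The restriction `A₀` of `A` to `ker R`, where `R` is a linear map defined on `D(A)`. -/
noncomputable def restrictKer {X Y W : Type*} [NormedAddCommGroup X] [NormedSpace ℂ X]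
    [NormedAddCommGroup Y] [NormedSpace ℂ Y] [NormedAddCommGroup W] [NormedSpace ℂ W]
    (A : Y →ₗ.[ℂ] X) (R : A.domain →ₗ[ℂ] W) : Y →ₗ.[ℂ] X :=
  A.domRestrict ((LinearMap.ker R).map A.domain.subtype)

/-- The operator `(A, R) : D(A) ⊆ Y → X × W`, `u ↦ (A u, R u)`. -/
def stackedOperator {X Y W : Type*} [NormedAddCommGroup X] [NormedSpace ℂ X]
    [NormedAddCommGroup Y] [NormedSpace ℂ Y] [NormedAddCommGroup W] [NormedSpace ℂ W]
    (A : Y →ₗ.[ℂ] X) (R : A.domain →ₗ[ℂ] W) : Y →ₗ.[ℂ] (X × W) where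
  domain := A.domain
  toFun := A.toFun.prod R

/-- The operator matrix with non-diagonal domain
`𝒜 (u, v, y) = (v, A u, (B₁ + B₄ B₂) u + B₄ y)` on `Y × X × W`, with domain
`D(𝒜) = {(u, v, y) | u ∈ D(A), v ∈ Y, R u = y}`. -/
noncomputable def acousticMatrix {X Y W : Type*} [NormedAddCommGroup X] [NormedSpace ℂ X]
    [NormedAddCommGroup Y] [NormedSpace ℂ Y] [NormedAddCommGroup W] [NormedSpace ℂ W]
    (ι : Y →L[ℂ] X) (hι : Function.Injective ι) (A : Y →ₗ.[ℂ] X) (R : A.domain →ₗ[ℂ] W)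
    (B₁ B₂ : Y →L[ℂ] W) (B₄ : W →L[ℂ] W) : (Y × X × W) →ₗ.[ℂ] (Y × X × W) where
  domain :=
    { carrier := {p | (∃ hu : p.1 ∈ A.domain, R ⟨p.1, hu⟩ = p.2.2) ∧
        p.2.1 ∈ (embeddingInverse ι hι).domain}
      add_mem' := by
        rintro p q ⟨⟨hp, hpR⟩, hpv⟩ ⟨⟨hq, hqR⟩, hqv⟩
        refine ⟨⟨add_mem hp hq, ?_⟩, add_mem hpv hqv⟩
        rw [Prod.snd_add, Prod.snd_add, ← hpR, ← hqR, ← map_add]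
        rfl
      zero_mem' := ⟨⟨zero_mem _, map_zero R⟩, zero_mem _⟩
      smul_mem' := by
        rintro c p ⟨⟨hp, hpR⟩, hpv⟩
        refine ⟨⟨A.domain.smul_mem c hp, ?_⟩, Submodule.smul_mem _ c hpv⟩
        rw [Prod.smul_snd, Prod.smul_snd, ← hpR, ← map_smul]
        rfl }
  toFun :=
    { toFun := fun p =>
        (embeddingInverse ι hι ⟨p.1.2.1, p.2.2⟩, A ⟨p.1.1, p.2.1.1⟩,
          (B₁ + B₄.comp B₂) p.1.1 + B₄ p.1.2.2)
      map_add' := fun p q => Prod.ext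
        ((embeddingInverse ι hι).map_add ⟨p.1.2.1, p.2.2⟩ ⟨q.1.2.1, q.2.2⟩)
        (Prod.ext (A.map_add ⟨p.1.1, p.2.1.1⟩ ⟨q.1.1, q.2.1.1⟩)
          (by
            change (B₁ + B₄.comp B₂) (p.1.1 + q.1.1) + B₄ (p.1.2.2 + q.1.2.2) = _ + _
            rw [map_add, map_add]
            exact add_add_add_comm _ _ _ _))
      map_smul' := fun c p => Prod.ext
        ((embeddingInverse ι hι).map_smul c ⟨p.1.2.1, p.2.2⟩)
        (Prod.ext (A.map_smul c ⟨p.1.1, p.2.1.1⟩)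
          (by
            change (B₁ + B₄.comp B₂) (c • p.1.1) + B₄ (c • p.1.2.2) = c • (_ + _)
            rw [map_smul, map_smul]
            exact (smul_add _ _ _).symm)) }

/-- The operator `T - μ` with the same domain as `T`. -/
def subScalar {E : Type*} [NormedAddCommGroup E] [NormedSpace ℂ E]
    (T : E →ₗ.[ℂ] E) (μ : ℂ) : E →ₗ.[ℂ] E where
  domain := T.domain
  toFun := T.toFun - μ • T.domain.subtype

/-- A closed, possibly unbounded operator is Fredholm if its kernel has finite dimension and its
range has finite codimension (on Banach spaces the range is then automatically closed). -/
structure IsFredholmOperator {E : Type*} [NormedAddCommGroup E] [NormedSpace ℂ E]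
    (T : E →ₗ.[ℂ] E) : Prop where
  isClosed : T.IsClosed
  finite_ker : FiniteDimensional ℂ (LinearMap.ker T.toFun)
  finite_coker : FiniteDimensional ℂ (E ⧸ LinearMap.range T.toFun)

/-- The Fredholm index `dim ker T - codim range T`, meaningful when `T` is Fredholm. -/
noncomputable def fredholmIndex {E : Type*} [NormedAddCommGroup E] [NormedSpace ℂ E]
    (T : E →ₗ.[ℂ] E) : ℤ :=
  (Module.finrank ℂ (LinearMap.ker T.toFun) : ℤ) -
    (Module.finrank ℂ (E ⧸ LinearMap.range T.toFun) : ℤ)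

/-- The (Fredholm) essential spectrum: all `μ` for which `T - μ` is not Fredholm. -/
def essentialSpectrum {E : Type*} [NormedAddCommGroup E] [NormedSpace ℂ E]
    (T : E →ₗ.[ℂ] E) : Set ℂ :=
  {μ | ¬ IsFredholmOperator (subScalar T μ)}

/-- A bounded operator on `E`, regarded as an operator with domain all of `E`. -/
def boundedOperator {E : Type*} [NormedAddCommGroup E] [NormedSpace ℂ E]
    (B : E →L[ℂ] E) : E →ₗ.[ℂ] E :=
  (B : E →ₗ[ℂ] E).toPMap ⊤

/-! The generator of a strongly continuous group has a resolvent point. Applied to the reduction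
matrix of `A₀`, and combined with surjectivity of `R`, this gives some `l` for which `u ↦ ((A - l)
u, R u)` is a bijection from `D(A)` onto `X × W` (`exists_bijective_shiftedStack`). Its inverse `P`,
read with values in `Y`, has closed graph and takes values in `Z`, so it is compact.

Hence `(f, g, w) ↦ (P (g, w), f + μ P (g, w), w)` parametrizes `D(𝒜)` by the whole space. In these
coordinates `𝒜 - μ` sends `(f, g, w)` to `(f, g + (l - μ²) P (g, w) - μ f, (B₄ - μ) w + (B₁ + B₄ B₂)
P (g, w))`, which is `id × id × (B₄ - μ)` plus a compact operator, by compactness of `P` and of `Y ↪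
X` (`exists_equiv_subScalar_acousticMatrix_comp_eq`). Kernel and cokernel dimensions ignore the
change of coordinates and the identity blocks, while finiteness and index survive compact
perturbation; closedness of `𝒜 - μ` comes from that of `(A, R)`.

For the last claim, on an infinite dimensional space the quotient by the compact operators is
nonzero, and left multiplication by `B₄` on it has a spectral point, at which `B₄ - μ` has no
parametrix. -/

/-! ### Linear algebra of maps with finite dimensional kernel and cokernel. -/

section AlgebraicFredholm

variable {𝕜 M M' N V : Type*} [Field 𝕜] [AddCommGroup M] [Module 𝕜 M] [AddCommGroup M']
  [Module 𝕜 M'] [AddCommGroup N] [Module 𝕜 N] [AddCommGroup V] [Module 𝕜 V]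

/-- A linear map whose kernel and cokernel are finite dimensional. -/
structure HasFiniteKerCoker (f : M →ₗ[𝕜] N) : Prop where
  ker : FiniteDimensional 𝕜 (LinearMap.ker f)
  coker : FiniteDimensional 𝕜 (N ⧸ LinearMap.range f)

theorem HasFiniteKerCoker.of_comp {f : M →ₗ[𝕜] N} {g : N →ₗ[𝕜] M'} {h : V →ₗ[𝕜] M}
    (hgf : HasFiniteKerCoker (g ∘ₗ f)) (hfh : HasFiniteKerCoker (f ∘ₗ h)) :
    HasFiniteKerCoker f where
  ker := by
    have := hgf.ker
    exact Submodule.finiteDimensional_of_le (LinearMap.ker_le_ker_comp f g)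
  coker := by
    have := hfh.coker
    exact Module.Finite.of_surjective
      (Submodule.factor (LinearMap.range_comp_le_range h f)) (Submodule.factor_surjective _)

theorem HasFiniteKerCoker.index_comp {f : M →ₗ[𝕜] N} {g : N →ₗ[𝕜] M'}
    (hg : HasFiniteKerCoker g) (hf : HasFiniteKerCoker f) :
    (g ∘ₗ f).index = g.index + f.index := by
  have := hg.ker
  have := hg.coker
  have := hf.ker
  have := hf.coker
  exact LinearMap.index_comp g

/-- Precomposition with a linear equivalence does not change the kernel up to isomorphism. -/
noncomputable def kerCompEquiv (f : M →ₗ[𝕜] N) (e : M' ≃ₗ[𝕜] M) :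
    LinearMap.ker (f ∘ₗ (e : M' →ₗ[𝕜] M)) ≃ₗ[𝕜] LinearMap.ker f :=
  e.ofSubmodules _ _ (by
    ext x
    simp only [Submodule.mem_map, LinearMap.mem_ker, LinearMap.comp_apply]
    exact ⟨by rintro ⟨y, hy, rfl⟩; exact hy, fun hx => ⟨e.symm x, by simpa using hx, by simp⟩⟩)

theorem hasFiniteKerCoker_comp_equiv_iff (f : M →ₗ[𝕜] N) (e : M' ≃ₗ[𝕜] M) :
    HasFiniteKerCoker (f ∘ₗ (e : M' →ₗ[𝕜] M)) ↔ HasFiniteKerCoker f := by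
  have hr : LinearMap.range (f ∘ₗ (e : M' →ₗ[𝕜] M)) = LinearMap.range f :=
    LinearMap.range_comp_of_range_eq_top f e.range
  constructor
  · rintro ⟨h1, h2⟩
    exact ⟨(kerCompEquiv f e).finiteDimensional, by rwa [hr] at h2⟩
  · rintro ⟨h1, h2⟩
    exact ⟨(kerCompEquiv f e).symm.finiteDimensional, by rwa [hr]⟩

theorem index_comp_equiv (f : M →ₗ[𝕜] N) (e : M' ≃ₗ[𝕜] M) :
    (f ∘ₗ (e : M' →ₗ[𝕜] M)).index = f.index := by
  have hr : LinearMap.range (f ∘ₗ (e : M' →ₗ[𝕜] M)) = LinearMap.range f :=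
    LinearMap.range_comp_of_range_eq_top f e.range
  rw [LinearMap.index_eq_finrank_sub, LinearMap.index_eq_finrank_sub, hr,
    (kerCompEquiv f e).finrank_eq]

/-- The kernel of `id × f` is that of `f`. -/
noncomputable def kerIdProdMapEquiv (f : M →ₗ[𝕜] N) :
    LinearMap.ker ((LinearMap.id : V →ₗ[𝕜] V).prodMap f) ≃ₗ[𝕜] LinearMap.ker f where
  toFun x := ⟨x.1.2, congrArg Prod.snd x.2⟩
  map_add' _ _ := rfl
  map_smul' _ _ := rfl
  invFun x := ⟨(0, x.1), Prod.ext rfl x.2⟩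
  left_inv x := Subtype.ext (Prod.ext (congrArg Prod.fst x.2).symm rfl)
  right_inv _ := rfl

/-- The cokernel of `id × f` is that of `f`. -/
noncomputable def cokerIdProdMapEquiv (f : M →ₗ[𝕜] N) :
    ((V × N) ⧸ LinearMap.range ((LinearMap.id : V →ₗ[𝕜] V).prodMap f)) ≃ₗ[𝕜]
      (N ⧸ LinearMap.range f) :=
  (Submodule.quotEquivOfEq _ _ (by
      ext ⟨v, y⟩
      simp only [LinearMap.mem_range, LinearMap.mem_ker, LinearMap.comp_apply,
        LinearMap.snd_apply, Submodule.mkQ_apply, Submodule.Quotient.mk_eq_zero, Prod.exists,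
        LinearMap.prodMap_apply, LinearMap.id_apply, Prod.mk.injEq]
      exact ⟨fun ⟨_, b, _, h⟩ => ⟨b, h⟩, fun ⟨b, h⟩ => ⟨v, b, rfl, h⟩⟩)).trans
    (LinearMap.quotKerEquivOfSurjective ((LinearMap.range f).mkQ ∘ₗ LinearMap.snd 𝕜 V N)
      ((Submodule.mkQ_surjective _).comp Prod.snd_surjective))

theorem hasFiniteKerCoker_id_prodMap_iff (f : M →ₗ[𝕜] N) :
    HasFiniteKerCoker ((LinearMap.id : V →ₗ[𝕜] V).prodMap f) ↔ HasFiniteKerCoker f := by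
  constructor
  · rintro ⟨h1, h2⟩
    exact ⟨(kerIdProdMapEquiv (V := V) f).finiteDimensional,
      (cokerIdProdMapEquiv (V := V) f).finiteDimensional⟩
  · rintro ⟨h1, h2⟩
    exact ⟨(kerIdProdMapEquiv f).symm.finiteDimensional,
      (cokerIdProdMapEquiv f).symm.finiteDimensional⟩

theorem index_id_prodMap (f : M →ₗ[𝕜] N) :
    ((LinearMap.id : V →ₗ[𝕜] V).prodMap f).index = f.index := by
  rw [LinearMap.index_eq_finrank_sub, LinearMap.index_eq_finrank_sub,
    (kerIdProdMapEquiv f).finrank_eq, (cokerIdProdMapEquiv f).finrank_eq]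

/-- Compares dimensions without finiteness: one of two bases always embeds in the other. It is later
applied to a complement of a range not yet known to be finite dimensional. -/
theorem exists_linearMap_injective_or_surjective (V V' : Type*) [AddCommGroup V] [Module 𝕜 V]
    [AddCommGroup V'] [Module 𝕜 V'] :
    ∃ L : V →ₗ[𝕜] V', Function.Injective L ∨ Function.Surjective L := by
  let b := Module.Basis.ofVectorSpace 𝕜 V
  let b' := Module.Basis.ofVectorSpace 𝕜 V'
  rcases Function.Embedding.total (Module.Basis.ofVectorSpaceIndex 𝕜 V)
    (Module.Basis.ofVectorSpaceIndex 𝕜 V') with ⟨⟨i⟩⟩ | ⟨⟨i⟩⟩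
  · exact ⟨b'.repr.symm.toLinearMap ∘ₗ Finsupp.lmapDomain 𝕜 𝕜 i ∘ₗ b.repr.toLinearMap,
      Or.inl (b'.repr.symm.injective.comp
        ((Finsupp.mapDomain_injective i.injective).comp b.repr.injective))⟩
  · obtain ⟨L, hL⟩ := LinearMap.exists_leftInverse_of_injective
      (b.repr.symm.toLinearMap ∘ₗ Finsupp.lmapDomain 𝕜 𝕜 i ∘ₗ b'.repr.toLinearMap)
      (LinearMap.ker_eq_bot.2 (b.repr.symm.injective.comp
        ((Finsupp.mapDomain_injective i.injective).comp b'.repr.injective)))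
    exact ⟨L, Or.inr fun y => ⟨_, LinearMap.congr_fun hL y⟩⟩

end AlgebraicFredholm

/-! ### Riesz theory and stability of the index under compact perturbations. -/

section CompactPerturbation

variable {𝕜 E F : Type*} [RCLike 𝕜] [NormedAddCommGroup E] [NormedSpace 𝕜 E]
  [NormedAddCommGroup F] [NormedSpace 𝕜 F]

theorem isCompactOperator_comp_of_finiteDimensional {G : Type*} [NormedAddCommGroup G]
    [NormedSpace 𝕜 G] [FiniteDimensional 𝕜 F] (g : F →L[𝕜] G) (f : E →L[𝕜] F) :
    IsCompactOperator (g.comp f) :=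
  have := FiniteDimensional.proper 𝕜 F
  (isCompactOperator_of_locallyCompactSpace_rng g).comp_clm f

theorem bijective_one_add_of_injective [CompleteSpace E] {K : E →L[𝕜] E} (hK : IsCompactOperator K)
    (h : Function.Injective (1 + K : E →L[𝕜] E)) : Function.Bijective (1 + K : E →L[𝕜] E) := by
  have hK' : IsCompactOperator (-K : E →L[𝕜] E) := hK.neg
  rcases hK'.hasEigenvalue_or_mem_resolventSet (μ := (1 : 𝕜)) one_ne_zero with h1 | h1
  · obtain ⟨v, hv⟩ := h1.exists_hasEigenvector
    refine absurd (h (a₁ := v) (a₂ := 0) ?_) hv.2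
    have := hv.apply_eq_smul
    simp only [ContinuousLinearMap.coe_coe, neg_apply, one_smul] at this
    simp only [add_apply, one_apply_eq_self, map_zero]
    rwa [← neg_eq_iff_add_eq_zero, neg_eq_iff_eq_neg, eq_comm]
  · rw [spectrum.mem_resolventSet_iff, map_one, sub_neg_eq_add] at h1
    exact ContinuousLinearMap.isUnit_iff_bijective.1 h1

/-- On this kernel `-K` acts as the identity, so the identity of the kernel is compact. -/
theorem finiteDimensional_ker_one_add {K : E →L[𝕜] E} (hK : IsCompactOperator K) :
    FiniteDimensional 𝕜 (LinearMap.ker ((1 + K : E →L[𝕜] E) : E →ₗ[𝕜] E)) := by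
  set U : E →L[𝕜] E := 1 + K with hU
  have hN : ∀ x ∈ LinearMap.ker (U : E →ₗ[𝕜] E), (-K) x = x := by
    intro x hx
    have : x + K x = 0 := hx
    rw [neg_apply]
    exact (eq_neg_of_add_eq_zero_left this).symm
  have hcl : IsClosed (LinearMap.ker (U : E →ₗ[𝕜] E) : Set E) := U.isClosed_ker
  have hK' : IsCompactOperator (-K : E →L[𝕜] E) := hK.neg
  have := hK'.restrict (f := ((-K : E →L[𝕜] E) : E →ₗ[𝕜] E)) (V := LinearMap.ker (U : E →ₗ[𝕜] E))
    (fun x hx => by rw [ContinuousLinearMap.coe_coe, hN x hx]; exact hx) hcl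
  refine FiniteDimensional.of_isCompactOperator_id (𝕜 := 𝕜) ?_
  refine (congrArg IsCompactOperator (funext fun x => ?_)).mp this
  exact Subtype.ext (hN x x.2)

theorem exists_projection_of_finiteDimensional (N : Submodule 𝕜 E) [FiniteDimensional 𝕜 N] :
    ∃ p : E →L[𝕜] N, ∀ x : N, p x = x :=
  Submodule.ClosedComplemented.of_finiteDimensional N

/-- The kernel of `U = 1 + K` is complemented, so a surjective `U` has a bounded right inverse `S`.
Then `S = 1 - K S` is injective and again a compact perturbation of `1`, hence bijective by the
Fredholm alternative, and `U` is its inverse. -/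
theorem injective_one_add_of_surjective [CompleteSpace E] {K : E →L[𝕜] E} (hK : IsCompactOperator K)
    (h : Function.Surjective (1 + K : E →L[𝕜] E)) : Function.Injective (1 + K : E →L[𝕜] E) := by
  set U : E →L[𝕜] E := 1 + K with hU
  obtain ⟨S, hS⟩ : ∃ S : E →L[𝕜] E, ∀ x, U (S x) = x := by
    have := finiteDimensional_ker_one_add hK
    obtain ⟨p, hp⟩ := exists_projection_of_finiteDimensional (LinearMap.ker (U : E →ₗ[𝕜] E))
    have hUp : ∀ x, U (p x) = 0 := fun x => (p x).2
    have : CompleteSpace (LinearMap.ker (p : E →ₗ[𝕜] LinearMap.ker (U : E →ₗ[𝕜] E))) :=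
      p.isClosed_ker.completeSpace_coe
    let e := ContinuousLinearEquiv.ofBijective
      (U.comp (LinearMap.ker (p : E →ₗ[𝕜] LinearMap.ker (U : E →ₗ[𝕜] E))).subtypeL)
      (by
        rw [LinearMap.ker_eq_bot']
        intro x hx
        have h1 : U x = 0 := hx
        have h2 : p (x : E) = 0 := x.2
        have h3 := hp ⟨x, h1⟩
        rw [h2] at h3
        exact Subtype.ext (congrArg Subtype.val h3).symm)
      (by
        rw [LinearMap.range_eq_top]
        intro y
        obtain ⟨x, rfl⟩ := h y
        refine ⟨⟨x - p x, ?_⟩, ?_⟩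
        · rw [LinearMap.mem_ker]
          simp [hp]
        · simp [hUp])
    exact ⟨(Submodule.subtypeL (LinearMap.ker (p : E →ₗ[𝕜] LinearMap.ker (U : E →ₗ[𝕜] E)))).comp
      e.symm.toContinuousLinearMap, fun x => e.apply_symm_apply x⟩
  have hS1 : S = 1 + -(K.comp S) := by
    ext x
    have := hS x
    simp only [hU, add_apply, one_apply_eq_self] at this
    simp only [add_apply, one_apply_eq_self,
      neg_apply, ContinuousLinearMap.comp_apply]
    rw [← sub_eq_add_neg, eq_sub_iff_add_eq, this]
  have hS2 : Function.Bijective S := by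
    have := bijective_one_add_of_injective (K := -(K.comp S)) (hK.comp_clm S).neg
    rw [← hS1] at this
    exact this (Function.LeftInverse.injective hS)
  intro x y hxy
  obtain ⟨a, rfl⟩ := hS2.2 x
  obtain ⟨b, rfl⟩ := hS2.2 y
  rw [hS, hS] at hxy
  rw [hxy]

/-- Take `L : ker U → C` injective or surjective and a projection `p` onto `ker U`. The finite rank
correction `U + L p` is still `1` plus a compact operator, and it inherits injectivity or
surjectivity from `L`; the Fredholm alternative makes it bijective, which forces the missing half of
bijectivity on `L`. -/
theorem exists_equiv_ker_of_isCompl [CompleteSpace E] {K : E →L[𝕜] E} (hK : IsCompactOperator K)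
    {C : Submodule 𝕜 E} (hC : IsCompl (LinearMap.range ((1 + K : E →L[𝕜] E) : E →ₗ[𝕜] E)) C) :
    Nonempty (LinearMap.ker ((1 + K : E →L[𝕜] E) : E →ₗ[𝕜] E) ≃ₗ[𝕜] C) := by
  have := finiteDimensional_ker_one_add hK
  set U : E →L[𝕜] E := 1 + K with hU
  obtain ⟨p, hp⟩ := exists_projection_of_finiteDimensional (LinearMap.ker (U : E →ₗ[𝕜] E))
  have hUp : ∀ x, U (p x) = 0 := fun x => (p x).2
  obtain ⟨L, hL⟩ := exists_linearMap_injective_or_surjective (𝕜 := 𝕜)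
    (LinearMap.ker (U : E →ₗ[𝕜] E)) C
  let Q : E →L[𝕜] E := (LinearMap.toContinuousLinearMap (C.subtype ∘ₗ L)).comp p
  have hQ : ∀ x, Q x = L (p x) := fun x => rfl
  have hQc : IsCompactOperator (K + Q) :=
    hK.add (g := Q) (isCompactOperator_comp_of_finiteDimensional _ p)
  have hUQ : ∀ x, (1 + (K + Q) : E →L[𝕜] E) x = U x + L (p x) := by
    intro x
    rw [← add_assoc, add_apply, hQ]
  have hdisj : ∀ x, ∀ c : C, U x + c = 0 → U x = 0 ∧ c = 0 := by
    intro x c hxc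
    have h1 : U x = 0 := Submodule.disjoint_def.1 hC.disjoint _ ⟨x, rfl⟩ (by
      rw [eq_neg_of_add_eq_zero_left hxc]; exact C.neg_mem c.2)
    exact ⟨h1, Subtype.ext (by simpa [h1] using hxc)⟩
  rcases hL with hL | hL
  · have hinj : Function.Injective (1 + (K + Q) : E →L[𝕜] E) := by
      rw [injective_iff_map_eq_zero]
      intro x hx
      rw [hUQ] at hx
      obtain ⟨h1, h2⟩ := hdisj _ _ hx
      have h3 : p x = 0 := hL (by rw [h2, map_zero])
      have h4 := hp ⟨x, h1⟩
      rw [h3] at h4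
      exact (congrArg Subtype.val h4).symm
    refine ⟨LinearEquiv.ofBijective L ⟨hL, fun c => ?_⟩⟩
    obtain ⟨x, hx⟩ := (bijective_one_add_of_injective hQc hinj).2 (c : E)
    rw [hUQ] at hx
    obtain ⟨-, h2⟩ := hdisj x (L (p x) - c) (by
      rw [Submodule.coe_sub, ← hx]; abel)
    exact ⟨p x, sub_eq_zero.1 h2⟩
  · have hsurj : Function.Surjective (1 + (K + Q) : E →L[𝕜] E) := by
      intro y
      obtain ⟨_, ⟨x, rfl⟩, c, hc, rfl⟩ := Submodule.mem_sup.1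
        (hC.sup_eq_top ▸ Submodule.mem_top : y ∈ _ ⊔ C)
      obtain ⟨n, hn⟩ := hL ⟨c, hc⟩
      -- Changing `x` inside its coset of `ker U` leaves `U x` alone and sets the `p`-component to
      -- `n`, so that `L p` contributes exactly `c`.
      refine ⟨x - p x + n, ?_⟩
      have h0 : U (n : E) = 0 := n.2
      rw [hUQ]
      simp [hp, hUp, hn, h0]
    have hinj := injective_one_add_of_surjective hQc hsurj
    refine ⟨LinearEquiv.ofBijective L ⟨?_, hL⟩⟩
    rw [injective_iff_map_eq_zero]
    intro n hn
    have h0 : U (n : E) = 0 := n.2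
    refine Subtype.ext (hinj ?_)
    rw [hUQ, hp, hn, h0]
    simp

/-- **Riesz's theorem**: the identity plus a compact operator is a Fredholm operator. -/
theorem hasFiniteKerCoker_one_add [CompleteSpace E] {K : E →L[𝕜] E} (hK : IsCompactOperator K) :
    HasFiniteKerCoker ((1 + K : E →L[𝕜] E) : E →ₗ[𝕜] E) := by
  have := finiteDimensional_ker_one_add hK
  obtain ⟨C, hC⟩ := Submodule.exists_isCompl (LinearMap.range ((1 + K : E →L[𝕜] E) : E →ₗ[𝕜] E))
  obtain ⟨e⟩ := exists_equiv_ker_of_isCompl hK hC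
  exact ⟨this, (e.trans (Submodule.quotientEquivOfIsCompl _ _ hC).symm).finiteDimensional⟩

/-- **Riesz's theorem**: the identity plus a compact operator has index zero. -/
theorem index_one_add [CompleteSpace E] {K : E →L[𝕜] E} (hK : IsCompactOperator K) :
    ((1 + K : E →L[𝕜] E) : E →ₗ[𝕜] E).index = 0 := by
  obtain ⟨C, hC⟩ := Submodule.exists_isCompl (LinearMap.range ((1 + K : E →L[𝕜] E) : E →ₗ[𝕜] E))
  obtain ⟨e⟩ := exists_equiv_ker_of_isCompl hK hC
  rw [LinearMap.index_eq_finrank_sub,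
    (e.trans (Submodule.quotientEquivOfIsCompl _ _ hC).symm).finrank_eq, sub_self]

/-- A bounded operator with finite dimensional kernel and cokernel is invertible modulo compact
operators. -/
theorem HasFiniteKerCoker.exists_parametrix [CompleteSpace E] [CompleteSpace F] {T : E →L[𝕜] F}
    (hT : HasFiniteKerCoker (T : E →ₗ[𝕜] F)) :
    ∃ S : F →L[𝕜] E, IsCompactOperator (S.comp T - 1 : E →L[𝕜] E) ∧
      IsCompactOperator (T.comp S - 1 : F →L[𝕜] F) := by
  have := hT.ker
  have := hT.coker
  obtain ⟨p, hp⟩ := exists_projection_of_finiteDimensional (LinearMap.ker (T : E →ₗ[𝕜] F))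
  have hTp : ∀ x, T (p x) = 0 := fun x => (p x).2
  obtain ⟨C, hC⟩ := Submodule.exists_isCompl (LinearMap.range (T : E →ₗ[𝕜] F))
  have : FiniteDimensional 𝕜 C := (Submodule.quotientEquivOfIsCompl _ _ hC).finiteDimensional
  let H := LinearMap.ker (p : E →ₗ[𝕜] LinearMap.ker (T : E →ₗ[𝕜] F))
  have : CompleteSpace H := p.isClosed_ker.completeSpace_coe
  have hTH : ∀ x : H, T x = 0 → x = 0 := by
    intro x hx
    have h2 : p (x : E) = 0 := x.2
    have h3 := hp ⟨x, hx⟩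
    rw [h2] at h3
    exact Subtype.ext (congrArg Subtype.val h3).symm
  have := FiniteDimensional.complete 𝕜 C
  -- `T` is injective on `H = ker p` with the same range as on `E`. Adding the finite dimensional
  -- `C` gives a continuous bijection of Banach spaces, so the open mapping theorem applies without
  -- knowing beforehand that the range of `T` is closed.
  let e : (H × C) ≃L[𝕜] F := ContinuousLinearEquiv.ofBijective
    ((T.comp H.subtypeL).coprod C.subtypeL)
    (by
      rw [LinearMap.ker_eq_bot']
      rintro ⟨x, c⟩ hx
      have hx' : T x + c = 0 := hx
      have h1 : T x = 0 := Submodule.disjoint_def.1 hC.disjoint _ ⟨x, rfl⟩ (by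
        rw [eq_neg_of_add_eq_zero_left hx']; exact C.neg_mem c.2)
      exact Prod.ext (hTH x h1) (Subtype.ext (by simpa [h1] using hx')))
    (by
      rw [LinearMap.range_eq_top]
      intro y
      obtain ⟨_, ⟨x, rfl⟩, c, hc, rfl⟩ := Submodule.mem_sup.1
        (hC.sup_eq_top ▸ Submodule.mem_top : y ∈ _ ⊔ C)
      refine ⟨(⟨x - p x, ?_⟩, ⟨c, hc⟩), ?_⟩
      · rw [LinearMap.mem_ker]
        simp [hp]
      · simp [hTp])
  have he : ∀ z : H × C, e z = T z.1 + z.2 := fun z => rfl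
  let S : F →L[𝕜] E := (H.subtypeL.comp (ContinuousLinearMap.fst 𝕜 H C)).comp (e.symm : F →L[𝕜] _)
  have hS : ∀ y, S y = (e.symm y).1 := fun y => rfl
  refine ⟨S, ?_, ?_⟩
  · have : (S.comp T - 1 : E →L[𝕜] E) = -((LinearMap.ker (T : E →ₗ[𝕜] F)).subtypeL.comp p) := by
      ext x
      have h1 : e.symm (T x) = (⟨x - p x, by rw [LinearMap.mem_ker]; simp [hp]⟩, 0) := by
        rw [ContinuousLinearEquiv.symm_apply_eq, he]
        simp [hTp]
      simp [hS, h1]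
    rw [this]
    exact (isCompactOperator_comp_of_finiteDimensional
      (LinearMap.ker (T : E →ₗ[𝕜] F)).subtypeL p).neg
  · have : (T.comp S - 1 : F →L[𝕜] F) =
        -(C.subtypeL.comp ((ContinuousLinearMap.snd 𝕜 H C).comp (e.symm : F →L[𝕜] _))) := by
      ext y
      have h1 := he (e.symm y)
      rw [e.apply_symm_apply] at h1
      simp only [sub_apply, ContinuousLinearMap.comp_apply, hS,
        one_apply_eq_self, neg_apply]
      rw [sub_eq_iff_eq_add', eq_comm, add_neg_eq_iff_eq_add]
      exact h1
    rw [this]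
    exact (isCompactOperator_comp_of_finiteDimensional C.subtypeL _).neg

/-- Both composites are `1` plus compact, so they have finite kernel and cokernel, which passes to
each factor; index zero of `T S` and additivity give opposite indices. The same `S` thus computes
the index of every compact perturbation of `T`. -/
theorem hasFiniteKerCoker_and_index_of_parametrix [CompleteSpace E] [CompleteSpace F]
    {T : E →L[𝕜] F} {S : F →L[𝕜] E} (hST : IsCompactOperator (S.comp T - 1 : E →L[𝕜] E))
    (hTS : IsCompactOperator (T.comp S - 1 : F →L[𝕜] F)) :
    HasFiniteKerCoker (T : E →ₗ[𝕜] F) ∧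
      (T : E →ₗ[𝕜] F).index = -(S : F →ₗ[𝕜] E).index := by
  have h1 := hasFiniteKerCoker_one_add hST
  have h2 := hasFiniteKerCoker_one_add hTS
  have h3 := index_one_add hTS
  rw [add_sub_cancel] at h1 h2 h3
  have hT : HasFiniteKerCoker (T : E →ₗ[𝕜] F) :=
    .of_comp (g := (S : F →ₗ[𝕜] E)) (h := (S : F →ₗ[𝕜] E)) h1 h2
  have hS : HasFiniteKerCoker (S : F →ₗ[𝕜] E) :=
    .of_comp (g := (T : E →ₗ[𝕜] F)) (h := (T : E →ₗ[𝕜] F)) h2 h1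
  refine ⟨hT, eq_neg_of_add_eq_zero_left ?_⟩
  rw [← hT.index_comp hS]
  exact h3

/-- The Fredholm property and the index are stable under compact perturbations. -/
theorem HasFiniteKerCoker.add_isCompactOperator [CompleteSpace E] [CompleteSpace F]
    {T K : E →L[𝕜] F} (hT : HasFiniteKerCoker (T : E →ₗ[𝕜] F)) (hK : IsCompactOperator K) :
    HasFiniteKerCoker ((T + K : E →L[𝕜] F) : E →ₗ[𝕜] F) ∧
      ((T + K : E →L[𝕜] F) : E →ₗ[𝕜] F).index = (T : E →ₗ[𝕜] F).index := by
  obtain ⟨S, h1, h2⟩ := hT.exists_parametrix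
  have h1' : IsCompactOperator (S.comp (T + K) - 1 : E →L[𝕜] E) := by
    rw [ContinuousLinearMap.comp_add, add_sub_right_comm]
    exact h1.add (hK.clm_comp S)
  have h2' : IsCompactOperator ((T + K).comp S - 1 : F →L[𝕜] F) := by
    rw [ContinuousLinearMap.add_comp, add_sub_right_comm]
    exact h2.add (hK.comp_clm S)
  obtain ⟨h3, h4⟩ := hasFiniteKerCoker_and_index_of_parametrix h1' h2'
  exact ⟨h3, by rw [h4, (hasFiniteKerCoker_and_index_of_parametrix h1 h2).2]⟩

theorem hasFiniteKerCoker_add_iff [CompleteSpace E] [CompleteSpace F]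
    {T K : E →L[𝕜] F} (hK : IsCompactOperator K) :
    HasFiniteKerCoker ((T + K : E →L[𝕜] F) : E →ₗ[𝕜] F) ↔
      HasFiniteKerCoker (T : E →ₗ[𝕜] F) := by
  refine ⟨fun h => ?_, fun h => (h.add_isCompactOperator hK).1⟩
  have h1 := (h.add_isCompactOperator (K := -K) hK.neg).1
  rwa [add_neg_cancel_right] at h1

end CompactPerturbation

/-! ### A resolvent point for the generator of a strongly continuous group. -/

section C0Group

variable {E : Type*} [NormedAddCommGroup E] [NormedSpace ℂ E] {T : ℝ → E →L[ℂ] E}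

theorem IsC0Group.tendsto_iff_hasDerivAt (hT : IsC0Group T) (x y : E) :
    Tendsto (fun t : ℝ => (t : ℂ)⁻¹ • (T t x - x)) (𝓝[≠] 0) (𝓝 y) ↔
      HasDerivAt (fun t : ℝ => T t x) y 0 := by
  rw [hasDerivAt_iff_tendsto_slope_zero]
  refine iff_of_eq (congrArg (fun f => Tendsto f (𝓝[≠] 0) (𝓝 y)) (funext fun t => ?_))
  rw [zero_add, hT.map_zero, ContinuousLinearMap.id_apply, ← Complex.ofReal_inv,
    Complex.coe_smul]

theorem IsC0Group.hasDerivAt (hT : IsC0Group T) {x y : E}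
    (h : HasDerivAt (fun t : ℝ => T t x) y 0) (t : ℝ) :
    HasDerivAt (fun t : ℝ => T t x) (T t y) t := by
  have h1 : HasDerivAt (fun s : ℝ => T (s - t) x) y t :=
    HasDerivAt.comp_sub_const t t (by rwa [sub_self])
  have h2 := ((T t).restrictScalars ℝ).hasFDerivAt.comp_hasDerivAt t h1
  refine h2.congr_of_eventuallyEq (Eventually.of_forall fun s => ?_)
  change T s x = T t (T (s - t) x)
  rw [← ContinuousLinearMap.comp_apply, ← hT.map_add, add_sub_cancel]

theorem hasDerivAt_cexp_mul_ofReal (z : ℂ) (t : ℝ) :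
    HasDerivAt (fun t : ℝ => Complex.exp (z * t)) (Complex.exp (z * t) * z) t := by
  have h1 : HasDerivAt (fun w : ℂ => z * w) z (t : ℂ) := by
    simpa using (hasDerivAt_id (t : ℂ)).const_mul z
  exact h1.cexp.comp_ofReal

/-- If `G x = l x` then the orbit of `x` is `exp (l t) x`. -/
theorem IsC0Group.exp_smul_apply_eq (hT : IsC0Group T) {x : E} {l : ℂ}
    (h : HasDerivAt (fun t : ℝ => T t x) (l • x) 0) (t : ℝ) :
    Complex.exp (-l * t) • T t x = x := by
  have hd : ∀ s : ℝ, HasDerivAt (fun s : ℝ => Complex.exp (-l * s) • T s x) 0 s := by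
    intro s
    have := (hasDerivAt_cexp_mul_ofReal (-l) s).smul (hT.hasDerivAt h s)
    rwa [map_smul, smul_smul, ← add_smul, mul_neg, add_neg_cancel, zero_smul] at this
  have := is_const_of_deriv_eq_zero (fun s => (hd s).differentiableAt) (fun s => (hd s).deriv) t 0
  simpa [hT.map_zero] using this

/-- For `u = ∫₀¹ exp (-l s) T(s) x ds` one has `G u = l u + exp (-l) T(1) x - x`. -/
theorem IsC0Group.hasDerivAt_integral [CompleteSpace E] (hT : IsC0Group T) (x : E) (l : ℂ) :
    HasDerivAt (fun t : ℝ => T t (∫ s in (0 : ℝ)..1, Complex.exp (-l * s) • T s x))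
      (l • (∫ s in (0 : ℝ)..1, Complex.exp (-l * s) • T s x) +
        (Complex.exp (-l) • T 1 x - x)) 0 := by
  set f : ℝ → E := fun s => Complex.exp (-l * s) • T s x with hf
  have hfc : Continuous f := by
    have := hT.strongly_continuous x
    fun_prop
  have hF : ∀ t, HasDerivAt (fun t => ∫ s in (0 : ℝ)..t, f s) (f t) t := fun t =>
    (hfc.integral_hasStrictDerivAt 0 t).hasDerivAt
  -- The group law turns `T h` into a translation of the integration interval, with factor `exp (l
  -- h)`; the result is then differentiable by the fundamental theorem of calculus.
  have hTu : ∀ h : ℝ, T h (∫ s in (0 : ℝ)..1, f s) =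
      Complex.exp (l * h) • ((∫ s in (0 : ℝ)..(h + 1), f s) - ∫ s in (0 : ℝ)..h, f s) := by
    intro h
    rw [intervalIntegral.integral_interval_sub_left (hfc.intervalIntegrable _ _)
      (hfc.intervalIntegrable _ _),
      ← (T h).intervalIntegral_comp_comm (hfc.intervalIntegrable _ _),
      ← intervalIntegral.integral_smul]
    have := intervalIntegral.integral_comp_add_left (a := 0) (b := 1)
      (fun s => Complex.exp (l * h) • f s) h
    rw [add_zero] at this
    rw [← this]
    refine intervalIntegral.integral_congr fun s _ => ?_
    simp only [hf]
    rw [map_smul, hT.map_add, smul_smul, ← Complex.exp_add, ContinuousLinearMap.comp_apply]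
    congr 2
    push_cast
    ring
  have h1 : HasDerivAt (fun h : ℝ => ∫ s in (0 : ℝ)..(h + 1), f s) (f 1) 0 :=
    HasDerivAt.comp_add_const (0 : ℝ) 1 (by rw [zero_add]; exact hF 1)
  have h2 := (hasDerivAt_cexp_mul_ofReal l 0).smul (h1.sub (hF 0))
  rw [funext hTu]
  refine HasDerivAt.congr_deriv h2 ?_
  simp [hf, hT.map_zero, add_comm]

/-- The generator of a strongly continuous group has nonempty resolvent set. -/
theorem GeneratesC0Group.exists_bijective_sub [CompleteSpace E] {G : E →ₗ.[ℂ] E}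
    (hG : GeneratesC0Group G) :
    ∃ l : ℂ, Function.Bijective (l • G.domain.subtype - G.toFun) := by
  obtain ⟨T, hT, hG⟩ := hG
  simp only [hT.tendsto_iff_hasDerivAt] at hG
  -- Since `exp l ≥ l + 1 > ‖T 1‖`, the operator `Q = exp (-l) T(1)` is a strict contraction and `1
  -- - Q` is invertible. An element of `ker (l - G)` is fixed by `Q`, hence zero; and `(l - G) u = x
  -- - Q x` for the integral `u` reaches every vector.
  let l : ℂ := (‖T 1‖ : ℝ)
  have hQ : ‖Complex.exp (-l) • T 1‖ < 1 := by
    rw [norm_smul, ← Complex.ofReal_neg, Complex.norm_exp_ofReal, Real.exp_neg,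
      inv_mul_lt_one₀ (Real.exp_pos _)]
    exact (lt_add_one _).trans_le (Real.add_one_le_exp _)
  have hb := ContinuousLinearMap.isUnit_iff_bijective.1 (isUnit_one_sub_of_norm_lt_one hQ)
  refine ⟨l, ?_, ?_⟩
  · rw [injective_iff_map_eq_zero]
    intro x hx
    have hx' : l • (x : E) - G x = 0 := hx
    have h1 := hT.exp_smul_apply_eq ((hG x (l • (x : E))).1
      ((LinearPMap.mem_graph_iff' _).2 ⟨x, by rw [sub_eq_zero.1 hx']⟩)) 1
    refine Subtype.ext (hb.1 ?_)
    simp only [sub_apply, one_apply_eq_self, smul_apply, Submodule.coe_zero, map_zero]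
    rw [sub_eq_zero]
    simpa using h1.symm
  · intro y
    obtain ⟨x, rfl⟩ := hb.2 y
    obtain ⟨u, hu⟩ := (LinearPMap.mem_graph_iff' _).1 ((hG _ _).2 (hT.hasDerivAt_integral x l))
    refine ⟨u, ?_⟩
    change l • (u : E) - G u = _
    rw [Prod.mk.injEq] at hu
    rw [hu.1, hu.2]
    simp

end C0Group

/-! ### Bounded operators modulo compact ones, and existence of essential spectrum. -/

section CompactQuotient

variable {E : Type*} [NormedAddCommGroup E] [NormedSpace ℂ E] [CompleteSpace E]

instance isClosed_compactOperator :
    IsClosed (compactOperator (RingHom.id ℂ) E E : Set (E →L[ℂ] E)) :=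
  isClosed_setOfPred_isCompactOperator

variable (E) in
/-- The bounded operators modulo the compact ones, as a Banach space. -/
def ModCompact : Type _ := (E →L[ℂ] E) ⧸ compactOperator (RingHom.id ℂ) E E

noncomputable instance : NormedAddCommGroup (ModCompact E) :=
  Submodule.Quotient.normedAddCommGroup (compactOperator (RingHom.id ℂ) E E)

noncomputable instance : NormedSpace ℂ (ModCompact E) :=
  Submodule.Quotient.normedSpace (compactOperator (RingHom.id ℂ) E E) ℂ

instance : CompleteSpace (ModCompact E) :=
  Submodule.Quotient.completeSpace (compactOperator (RingHom.id ℂ) E E)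

/-- The class of a bounded operator modulo the compact ones. -/
noncomputable def ModCompact.mk : (E →L[ℂ] E) →ₗ[ℂ] ModCompact E :=
  (compactOperator (RingHom.id ℂ) E E).mkQ

theorem ModCompact.mk_surjective : Function.Surjective (ModCompact.mk : (E →L[ℂ] E) → _) :=
  Submodule.mkQ_surjective (compactOperator (RingHom.id ℂ) E E)

theorem ModCompact.mk_eq_zero {B : E →L[ℂ] E} : ModCompact.mk B = 0 ↔ IsCompactOperator B :=
  Submodule.Quotient.mk_eq_zero (compactOperator (RingHom.id ℂ) E E)

theorem ModCompact.isQuotientMap_mk : IsQuotientMap (ModCompact.mk : (E →L[ℂ] E) → _) :=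
  isQuotientMap_quot_mk

/-- Left multiplication by a bounded operator on the bounded operators modulo the compact ones. -/
noncomputable def ModCompact.leftMul (B : E →L[ℂ] E) : ModCompact E →L[ℂ] ModCompact E where
  toLinearMap := Submodule.mapQ (compactOperator (RingHom.id ℂ) E E)
    (compactOperator (RingHom.id ℂ) E E) (ContinuousLinearMap.compL ℂ E E E B).toLinearMap
    fun _ hK => IsCompactOperator.clm_comp hK B
  cont := ModCompact.isQuotientMap_mk.continuous_iff.2
    (ModCompact.isQuotientMap_mk.continuous.comp (ContinuousLinearMap.compL ℂ E E E B).continuous)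

theorem ModCompact.leftMul_mk (B C : E →L[ℂ] E) : leftMul B (mk C) = mk (B.comp C) := rfl

theorem ModCompact.leftMul_comp (B C : E →L[ℂ] E) :
    leftMul (B.comp C) = leftMul B * leftMul C := by
  ext x
  obtain ⟨D, rfl⟩ := mk_surjective x
  rfl

theorem ModCompact.leftMul_sub_smul (B : E →L[ℂ] E) (μ : ℂ) :
    leftMul (B - μ • 1) = leftMul B - algebraMap ℂ _ μ := by
  ext x
  obtain ⟨D, rfl⟩ := mk_surjective x
  rw [sub_apply, leftMul_mk, leftMul_mk, Algebra.algebraMap_eq_smul_one,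
    smul_apply, one_apply_eq_self, ← map_smul, ← map_sub]
  rfl

theorem ModCompact.leftMul_eq_one {B : E →L[ℂ] E} (hB : IsCompactOperator (B - 1 : E →L[ℂ] E)) :
    leftMul B = 1 := by
  ext x
  obtain ⟨D, rfl⟩ := mk_surjective x
  rw [leftMul_mk, one_apply_eq_self, ← sub_eq_zero, ← map_sub, mk_eq_zero]
  exact hB.comp_clm D

/-- A Banach space carrying a bounded operator all of whose translates are Fredholm is
finite dimensional. -/
theorem FiniteDimensional.of_forall_hasFiniteKerCoker_sub {B : E →L[ℂ] E}
    (h : ∀ μ : ℂ, HasFiniteKerCoker ((B - μ • 1 : E →L[ℂ] E) : E →ₗ[ℂ] E)) :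
    FiniteDimensional ℂ E := by
  by_contra hE
  have : Nontrivial (ModCompact E) := ⟨ModCompact.mk 1, 0, fun h1 => hE
    (FiniteDimensional.of_isCompactOperator_id (𝕜 := ℂ) (ModCompact.mk_eq_zero.1 h1))⟩
  -- The spectrum is taken in the Banach algebra of bounded operators on the quotient. A parametrix
  -- of `B - μ` becomes a two-sided inverse there, contradicting the choice of `μ`.
  obtain ⟨μ, hμ⟩ := spectrum.nonempty (ModCompact.leftMul B)
  obtain ⟨S, h1, h2⟩ := (h μ).exists_parametrix
  have h1' := ModCompact.leftMul_eq_one h1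
  have h2' := ModCompact.leftMul_eq_one h2
  rw [ModCompact.leftMul_comp, ModCompact.leftMul_sub_smul] at h1' h2'
  refine hμ ?_
  rw [spectrum.mem_resolventSet_iff, ← neg_sub, IsUnit.neg_iff]
  exact ⟨⟨_, _, h2', h1'⟩, rfl⟩

end CompactQuotient

/-! ### Closedness and factorization of the operator matrix. -/

section LinearPMap

variable {X Y W : Type*} [NormedAddCommGroup X] [NormedSpace ℂ X]
  [NormedAddCommGroup Y] [NormedSpace ℂ Y] [NormedAddCommGroup W] [NormedSpace ℂ W]

theorem fredholmIndex_eq_index {E : Type*} [NormedAddCommGroup E] [NormedSpace ℂ E]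
    (T : E →ₗ.[ℂ] E) : fredholmIndex T = T.toFun.index := by
  rw [fredholmIndex, LinearMap.index_eq_finrank_sub]

theorem isFredholmOperator_iff {E : Type*} [NormedAddCommGroup E] [NormedSpace ℂ E]
    {T : E →ₗ.[ℂ] E} (hT : T.IsClosed) : IsFredholmOperator T ↔ HasFiniteKerCoker T.toFun :=
  ⟨fun h => ⟨h.2, h.3⟩, fun h => ⟨hT, h.1, h.2⟩⟩

theorem mem_graph_subScalar_boundedOperator (B : W →L[ℂ] W) (μ : ℂ) (x y : W) :
    (x, y) ∈ (subScalar (boundedOperator B) μ).graph ↔ B x - μ • x = y := by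
  rw [LinearPMap.mem_graph_iff']
  constructor
  · rintro ⟨z, hz⟩
    rw [Prod.mk.injEq] at hz
    rw [← hz.1, ← hz.2]
    rfl
  · rintro rfl
    exact ⟨⟨x, Submodule.mem_top⟩, rfl⟩

theorem isClosed_subScalar_boundedOperator (B : W →L[ℂ] W) (μ : ℂ) :
    (subScalar (boundedOperator B) μ).IsClosed := by
  have : ((subScalar (boundedOperator B) μ).graph : Set (W × W)) =
      {p | B p.1 - μ • p.1 = p.2} :=
    Set.ext fun p => mem_graph_subScalar_boundedOperator B μ p.1 p.2
  rw [LinearPMap.IsClosed, this]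
  exact isClosed_eq (by fun_prop) (by fun_prop)

theorem toFun_subScalar_boundedOperator (B : W →L[ℂ] W) (μ : ℂ) :
    (subScalar (boundedOperator B) μ).toFun =
      ((B - μ • 1 : W →L[ℂ] W) : W →ₗ[ℂ] W) ∘ₗ
        (Submodule.topEquiv : (⊤ : Submodule ℂ W) ≃ₗ[ℂ] W).toLinearMap := rfl

theorem isFredholmOperator_subScalar_boundedOperator_iff (B : W →L[ℂ] W) (μ : ℂ) :
    IsFredholmOperator (subScalar (boundedOperator B) μ) ↔
      HasFiniteKerCoker ((B - μ • 1 : W →L[ℂ] W) : W →ₗ[ℂ] W) := by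
  rw [isFredholmOperator_iff (isClosed_subScalar_boundedOperator B μ),
    toFun_subScalar_boundedOperator]
  exact hasFiniteKerCoker_comp_equiv_iff _ _

theorem fredholmIndex_subScalar_boundedOperator (B : W →L[ℂ] W) (μ : ℂ) :
    fredholmIndex (subScalar (boundedOperator B) μ) =
      ((B - μ • 1 : W →L[ℂ] W) : W →ₗ[ℂ] W).index := by
  rw [fredholmIndex_eq_index, toFun_subScalar_boundedOperator]
  exact index_comp_equiv _ _

theorem essentialSpectrum_boundedOperator_eq_empty_iff [CompleteSpace W] (B : W →L[ℂ] W) :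
    essentialSpectrum (boundedOperator B) = ∅ ↔ FiniteDimensional ℂ W := by
  rw [essentialSpectrum, Set.eq_empty_iff_forall_notMem]
  simp only [Set.mem_ofPred_eq, not_not, isFredholmOperator_subScalar_boundedOperator_iff]
  exact ⟨FiniteDimensional.of_forall_hasFiniteKerCoker_sub,
    fun _ _ => ⟨inferInstance, inferInstance⟩⟩

theorem embeddingInverse_apply (ι : Y →L[ℂ] X) (hι : Function.Injective ι) (y : Y)
    (h : ι y ∈ (embeddingInverse ι hι).domain) : embeddingInverse ι hι ⟨ι y, h⟩ = y := by
  change (LinearEquiv.ofInjective (ι : Y →ₗ[ℂ] X) hι).symm ⟨ι y, h⟩ = y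
  rw [LinearEquiv.symm_apply_eq]
  rfl

theorem mem_graph_stackedOperator (A : Y →ₗ.[ℂ] X) (R : A.domain →ₗ[ℂ] W) (u : Y) (x : X) (w : W) :
    (u, (x, w)) ∈ (stackedOperator A R).graph ↔
      ∃ hu : u ∈ A.domain, A ⟨u, hu⟩ = x ∧ R ⟨u, hu⟩ = w := by
  rw [LinearPMap.mem_graph_iff']
  constructor
  · rintro ⟨z, hz⟩
    simp only [Prod.mk.injEq] at hz
    obtain ⟨rfl, hz⟩ := hz
    exact ⟨z.2, congrArg Prod.fst hz, congrArg Prod.snd hz⟩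
  · rintro ⟨hu, rfl, rfl⟩
    exact ⟨⟨u, hu⟩, rfl⟩

/-- Rewrites the rows of the matrix as conditions free of domain proofs; each is closed once `(A,
R)` is, and the factorization is checked through them. -/
theorem mem_graph_subScalar_acousticMatrix (ι : Y →L[ℂ] X) (hι : Function.Injective ι)
    (A : Y →ₗ.[ℂ] X) (R : A.domain →ₗ[ℂ] W) (B₁ B₂ : Y →L[ℂ] W) (B₄ : W →L[ℂ] W) (μ : ℂ)
    (p q : Y × X × W) :
    (p, q) ∈ (subScalar (acousticMatrix ι hι A R B₁ B₂ B₄) μ).graph ↔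
      p.2.1 = ι (q.1 + μ • p.1) ∧
      (p.1, (q.2.1 + μ • p.2.1, p.2.2)) ∈ (stackedOperator A R).graph ∧
      (B₁ + B₄.comp B₂) p.1 + B₄ p.2.2 - μ • p.2.2 = q.2.2 := by
  obtain ⟨u, x, w⟩ := p
  obtain ⟨f, g, h⟩ := q
  rw [LinearPMap.mem_graph_iff', mem_graph_stackedOperator]
  constructor
  · rintro ⟨⟨⟨u', x', w'⟩, ⟨hu, hR⟩, y, hy⟩, hz⟩
    rw [Prod.mk.injEq, Prod.mk.injEq, Prod.mk.injEq] at hz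
    obtain ⟨⟨rfl, rfl, rfl⟩, hz⟩ := hz
    change ι y = x' at hy
    subst hy
    have h1 : embeddingInverse ι hι ⟨ι y, _⟩ - μ • u' = f := congrArg Prod.fst hz
    have h2 : A ⟨u', hu⟩ - μ • ι y = g := congrArg (fun z => z.2.1) hz
    have h3 : (B₁ + B₄.comp B₂) u' + B₄ w' - μ • w' = h := congrArg (fun z => z.2.2) hz
    rw [embeddingInverse_apply] at h1
    exact ⟨by rw [← h1, sub_add_cancel], ⟨hu, by rw [← h2, sub_add_cancel], hR⟩, h3⟩
  · rintro ⟨h1, ⟨hu, h2, h3⟩, h4⟩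
    simp only at h1 hu h2 h3 h4
    subst h1
    refine ⟨⟨(u, ι (f + μ • u), w), ⟨hu, h3⟩, ⟨_, rfl⟩⟩, ?_⟩
    refine Prod.ext rfl (Prod.ext ?_ (Prod.ext ?_ h4))
    · change embeddingInverse ι hι ⟨ι (f + μ • u), _⟩ - μ • u = f
      rw [embeddingInverse_apply, add_sub_cancel_right]
    · change A ⟨u, hu⟩ - μ • ι (f + μ • u) = g
      rw [h2, add_sub_cancel_right]

theorem isClosed_subScalar_acousticMatrix (ι : Y →L[ℂ] X) (hι : Function.Injective ι)
    (A : Y →ₗ.[ℂ] X) (R : A.domain →ₗ[ℂ] W) (B₁ B₂ : Y →L[ℂ] W) (B₄ : W →L[ℂ] W) (μ : ℂ)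
    (hclosed : (stackedOperator A R).IsClosed) :
    (subScalar (acousticMatrix ι hι A R B₁ B₂ B₄) μ).IsClosed := by
  rw [LinearPMap.IsClosed] at hclosed ⊢
  have : ((subScalar (acousticMatrix ι hι A R B₁ B₂ B₄) μ).graph : Set _) =
      {z : (Y × X × W) × (Y × X × W) | z.1.2.1 = ι (z.2.1 + μ • z.1.1)} ∩
      ((fun z : (Y × X × W) × (Y × X × W) => (z.1.1, (z.2.2.1 + μ • z.1.2.1, z.1.2.2))) ⁻¹'
        ((stackedOperator A R).graph : Set _) ∩
      {z | (B₁ + B₄.comp B₂) z.1.1 + B₄ z.1.2.2 - μ • z.1.2.2 = z.2.2.2}) :=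
    Set.ext fun z => mem_graph_subScalar_acousticMatrix ι hι A R B₁ B₂ B₄ μ z.1 z.2
  rw [this]
  exact (isClosed_eq (by fun_prop) (by fun_prop)).inter
    ((hclosed.preimage (by fun_prop)).inter (isClosed_eq (by fun_prop) (by fun_prop)))

/-- The operator `u ↦ ((A - l) u, R u)` on the domain of `A`. -/
noncomputable def shiftedStack (ι : Y →L[ℂ] X) (A : Y →ₗ.[ℂ] X) (R : A.domain →ₗ[ℂ] W) (l : ℂ) :
    A.domain →ₗ[ℂ] X × W :=
  (A.toFun - l • (ι : Y →ₗ[ℂ] X) ∘ₗ A.domain.subtype).prod R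

theorem shiftedStack_apply (ι : Y →L[ℂ] X) (A : Y →ₗ.[ℂ] X) (R : A.domain →ₗ[ℂ] W) (l : ℂ)
    (u : A.domain) : shiftedStack ι A R l u = (A u - l • ι u, R u) := rfl

/-- If `l` is a resolvent point of the reduction matrix, eliminating the second component shows that
`A₀ - l²` is bijective, so `l * l` is the witness. A preimage of `(g, w)` is a lift `u₁` of `w`
under `R`, corrected by an element of `ker R`. -/
theorem exists_bijective_shiftedStack [CompleteSpace X] [CompleteSpace Y] (ι : Y →L[ℂ] X)
    (hι : Function.Injective ι) (A : Y →ₗ.[ℂ] X) (R : A.domain →ₗ[ℂ] W)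
    (hR : Function.Surjective R)
    (hG : GeneratesC0Group (reductionMatrix ι hι (restrictKer A R))) :
    ∃ l : ℂ, Function.Bijective (shiftedStack ι A R l) := by
  obtain ⟨l, hinj, hsurj⟩ := hG.exists_bijective_sub
  have hdom : ∀ u : A.domain, R u = 0 → (u : Y) ∈ (restrictKer A R).domain := fun u hu =>
    ⟨⟨u, hu, rfl⟩, u.2⟩
  refine ⟨l * l, ?_, ?_⟩
  · rw [injective_iff_map_eq_zero]
    intro u hu
    rw [shiftedStack_apply, Prod.mk_eq_zero, sub_eq_zero] at hu
    let z : (reductionMatrix ι hι (restrictKer A R)).domain :=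
      ⟨((u : Y), ι (l • (u : Y))), hdom u hu.2, ⟨_, rfl⟩⟩
    have hz : (l • (reductionMatrix ι hι (restrictKer A R)).domain.subtype -
        (reductionMatrix ι hι (restrictKer A R)).toFun) z = 0 := by
      refine Prod.ext ?_ ?_
      · change l • (u : Y) - embeddingInverse ι hι ⟨ι (l • (u : Y)), _⟩ = 0
        rw [embeddingInverse_apply, sub_self]
      · change l • ι (l • (u : Y)) - A u = 0
        rw [hu.1, map_smul, smul_smul, sub_self]
    have hz0 := (injective_iff_map_eq_zero _).1 hinj z hz
    exact Subtype.ext (congrArg (fun z => z.1.1) hz0)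
  · rintro ⟨g, w⟩
    obtain ⟨u₁, rfl⟩ := hR w
    obtain ⟨⟨⟨u, x⟩, ⟨⟨⟨u₀, hu₀, hu⟩, hu'⟩, y, hy⟩⟩, hz⟩ :=
      hsurj (0, A u₁ - (l * l) • ι u₁ - g)
    change ι y = x at hy
    subst hy
    have h1 : l • u - embeddingInverse ι hι ⟨ι y, _⟩ = 0 := congrArg Prod.fst hz
    have h2 : l • ι y - A ⟨u, hu'⟩ = A u₁ - (l * l) • ι u₁ - g := congrArg Prod.snd hz
    rw [embeddingInverse_apply, sub_eq_zero] at h1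
    have h3 : u₀ = ⟨u, hu'⟩ := Subtype.ext hu
    have h4 : R u₀ = 0 := hu₀
    refine ⟨u₁ + u₀, ?_⟩
    rw [shiftedStack_apply, map_add, h4, add_zero, LinearPMap.map_add, h3]
    refine Prod.ext ?_ rfl
    rw [← h1, map_smul, smul_smul] at h2
    simp only [Submodule.coe_add, map_add, smul_add]
    rw [sub_eq_sub_iff_add_eq_add] at h2
    have h5 : g = A u₁ - (l * l) • ι u₁ + A ⟨u, hu'⟩ - (l * l) • ι u := by
      rw [eq_sub_iff_add_eq, add_comm, h2]
    rw [h5]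
    abel

/-- A linear map with closed graph whose values lie in a compactly embedded subspace is compact. -/
theorem isCompactOperator_of_isClosed_graph {F Z : Type*} [NormedAddCommGroup F] [NormedSpace ℂ F]
    [CompleteSpace F] [NormedAddCommGroup Z] [NormedSpace ℂ Z] [CompleteSpace Z]
    (P : F →ₗ[ℂ] Y) (hP : IsClosed (P.graph : Set (F × Y)))
    (j : Z →L[ℂ] Y) (hj : Function.Injective j) (hjc : IsCompactOperator j)
    (hPj : ∀ x, P x ∈ LinearMap.range (j : Z →ₗ[ℂ] Y)) : IsCompactOperator P := by
  let Q : F →ₗ[ℂ] Z := (LinearEquiv.ofInjective (j : Z →ₗ[ℂ] Y) hj).symm.toLinearMap ∘ₗ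
    P.codRestrict _ hPj
  have hQ : ∀ x, j (Q x) = P x := fun x =>
    congrArg Subtype.val ((LinearEquiv.ofInjective (j : Z →ₗ[ℂ] Y) hj).apply_symm_apply
      (P.codRestrict _ hPj x))
  -- Continuity of `j` pulls closedness of the graph back to `F × Z`, so the closed graph theorem
  -- applies in the finer topology of `Z`.
  have hgraph : (Q.graph : Set (F × Z)) = (fun z : F × Z => (z.1, j z.2)) ⁻¹' P.graph := by
    ext ⟨x, z⟩
    simp only [SetLike.mem_coe, LinearMap.mem_graph_iff, Set.mem_preimage, ← hQ]
    exact ⟨fun h => by rw [h], fun h => hj h⟩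
  have hQc : Continuous Q := Q.continuous_of_isClosed_graph (by
    rw [hgraph]; exact hP.preimage (by fun_prop))
  have : (P : F → Y) = j ∘ (⟨Q, hQc⟩ : F →L[ℂ] Z) := funext fun x => (hQ x).symm
  rw [this]
  exact hjc.comp_clm _

/-- The graph of the inverse is a continuous preimage of the closed graph of `(A, R)`, and its
values lie in `D(A)`, hence in `Z`. -/
theorem isCompactOperator_subtype_shiftedStack_symm [CompleteSpace X] [CompleteSpace W] {Z : Type*}
    [NormedAddCommGroup Z] [NormedSpace ℂ Z] [CompleteSpace Z] (ι : Y →L[ℂ] X)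
    (A : Y →ₗ.[ℂ] X) (R : A.domain →ₗ[ℂ] W) (hclosed : (stackedOperator A R).IsClosed)
    (j : Z →L[ℂ] Y) (hj : Function.Injective j) (hjc : IsCompactOperator j)
    (hZ : A.domain ≤ LinearMap.range (j : Z →ₗ[ℂ] Y)) (l : ℂ)
    (hl : Function.Bijective (shiftedStack ι A R l)) :
    IsCompactOperator (A.domain.subtype ∘ₗ
      (LinearEquiv.ofBijective (shiftedStack ι A R l) hl).symm.toLinearMap) := by
  refine isCompactOperator_of_isClosed_graph _ ?_ j hj hjc fun x => hZ (Subtype.prop _)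
  set e := LinearEquiv.ofBijective (shiftedStack ι A R l) hl with he
  have : ((A.domain.subtype ∘ₗ e.symm.toLinearMap).graph : Set ((X × W) × Y)) =
      (fun z : (X × W) × Y => (z.2, (z.1.1 + l • ι z.2, z.1.2))) ⁻¹'
        ((stackedOperator A R).graph : Set _) := by
    ext ⟨⟨x, w⟩, u⟩
    simp only [SetLike.mem_coe, LinearMap.mem_graph_iff, Set.mem_preimage,
      mem_graph_stackedOperator]
    constructor
    · rintro rfl
      have h1 : shiftedStack ι A R l (e.symm (x, w)) = (x, w) := e.apply_symm_apply (x, w)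
      rw [shiftedStack_apply, Prod.mk.injEq] at h1
      exact ⟨Subtype.prop _, eq_add_of_sub_eq h1.1, h1.2⟩
    · rintro ⟨hu, h1, h2⟩
      have h3 : e.symm (x, w) = ⟨u, hu⟩ := by
        rw [LinearEquiv.symm_apply_eq]
        change _ = shiftedStack ι A R l ⟨u, hu⟩
        rw [shiftedStack_apply, h1, h2, add_sub_cancel_right]
      change u = (e.symm (x, w) : Y)
      rw [h3]
  rw [this]
  exact IsClosed.preimage (by fun_prop) hclosed

/-- `𝒜 - μ` is, up to an isomorphism onto its domain, a compact perturbation of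
`id × id × (B₄ - μ)`. -/
theorem exists_equiv_subScalar_acousticMatrix_comp_eq (ι : Y →L[ℂ] X) (hι : Function.Injective ι)
    (A : Y →ₗ.[ℂ] X) (R : A.domain →ₗ[ℂ] W) (B₁ B₂ : Y →L[ℂ] W) (B₄ : W →L[ℂ] W) (μ : ℂ)
    (hιc : IsCompactOperator ι) (l : ℂ) (hl : Function.Bijective (shiftedStack ι A R l))
    (hP : IsCompactOperator (A.domain.subtype ∘ₗ
      (LinearEquiv.ofBijective (shiftedStack ι A R l) hl).symm.toLinearMap)) :
    ∃ (e : (Y × X × W) ≃ₗ[ℂ] (subScalar (acousticMatrix ι hι A R B₁ B₂ B₄) μ).domain)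
      (K : (Y × X × W) →L[ℂ] (Y × X × W)), IsCompactOperator K ∧
      (subScalar (acousticMatrix ι hι A R B₁ B₂ B₄) μ).toFun ∘ₗ e.toLinearMap =
        (((ContinuousLinearMap.id ℂ Y).prodMap ((ContinuousLinearMap.id ℂ X).prodMap
          (B₄ - μ • 1)) + K : (Y × X × W) →L[ℂ] (Y × X × W)) : _ →ₗ[ℂ] _) := by
  set s := LinearEquiv.ofBijective (shiftedStack ι A R l) hl with hs
  let P : (X × W) →L[ℂ] Y := ContinuousLinearMap.mkOfIsCompactOperator hP
  have hPs : ∀ q, P q = s.symm q := fun q => rfl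
  have hPc : IsCompactOperator P := hP
  have hsA : ∀ q : X × W, A (s.symm q) = q.1 + l • ι (P q) ∧ R (s.symm q) = q.2 := by
    intro q
    have h1 : shiftedStack ι A R l (s.symm q) = q := s.apply_symm_apply q
    rw [shiftedStack_apply] at h1
    exact ⟨eq_add_of_sub_eq (congrArg Prod.fst h1), congrArg Prod.snd h1⟩
  -- The second component is chosen so that the first row of `𝒜 - μ` returns exactly `f`.
  let V : (Y × X × W) →L[ℂ] (Y × X × W) :=
    (P.comp (.snd ℂ Y (X × W))).prod
      ((ι.comp (.fst ℂ Y (X × W) + μ • P.comp (.snd ℂ Y (X × W)))).prod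
        ((ContinuousLinearMap.snd ℂ X W).comp (.snd ℂ Y (X × W))))
  have hV : ∀ p, V p = (P p.2, ι (p.1 + μ • P p.2), p.2.2) := fun p => rfl
  let K : (Y × X × W) →L[ℂ] (Y × X × W) :=
    (ContinuousLinearMap.inr ℂ Y (X × W)).comp
      ((ContinuousLinearMap.inl ℂ X W).comp ((l - μ * μ) • ι.comp (P.comp (.snd ℂ Y (X × W)))
        - μ • ι.comp (.fst ℂ Y (X × W))) +
      (ContinuousLinearMap.inr ℂ X W).comp ((B₁ + B₄.comp B₂).comp (P.comp (.snd ℂ Y (X × W)))))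
  have hK : ∀ p, K p = (0, (l - μ * μ) • ι (P p.2) - μ • ι p.1, (B₁ + B₄.comp B₂) (P p.2)) := by
    intro p
    simp [K]
  have hKc : IsCompactOperator K := by
    have h1 : IsCompactOperator (P.comp (.snd ℂ Y (X × W)) : Y × X × W →L[ℂ] Y) :=
      hPc.comp_clm (ContinuousLinearMap.snd ℂ Y (X × W))
    have h2 : IsCompactOperator (ι.comp (.fst ℂ Y (X × W)) : Y × X × W →L[ℂ] X) :=
      hιc.comp_clm (ContinuousLinearMap.fst ℂ Y (X × W))
    have h3 := ((h1.clm_comp ι).smul (l - μ * μ)).sub (h2.smul μ)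
    have h4 := h1.clm_comp (B₁ + B₄.comp B₂)
    exact ((h3.clm_comp (ContinuousLinearMap.inl ℂ X W)).add
      (h4.clm_comp (ContinuousLinearMap.inr ℂ X W))).clm_comp
      (ContinuousLinearMap.inr ℂ Y (X × W))
  have hgraph : ∀ p, (V p, ((ContinuousLinearMap.id ℂ Y).prodMap
      ((ContinuousLinearMap.id ℂ X).prodMap (B₄ - μ • 1)) + K : (Y × X × W) →L[ℂ] _) p) ∈
        (subScalar (acousticMatrix ι hι A R B₁ B₂ B₄) μ).graph := by
    rintro ⟨f, g, w⟩
    rw [mem_graph_subScalar_acousticMatrix, mem_graph_stackedOperator, hV, add_apply, hK]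
    refine ⟨by simp, ⟨(s.symm (g, w)).2, ?_, (hsA (g, w)).2⟩, by simp; abel⟩
    refine (hsA (g, w)).1.trans ?_
    change g + l • ι (P (g, w)) =
      g + ((l - μ * μ) • ι (P (g, w)) - μ • ι f) + μ • ι (f + μ • P (g, w))
    rw [map_add, map_smul]
    module
  have hdom : ∀ p, V p ∈ (subScalar (acousticMatrix ι hι A R B₁ B₂ B₄) μ).domain := fun p =>
    LinearPMap.mem_domain_of_mem_graph (hgraph p)
  have hbij : Function.Bijective ((V : (Y × X × W) →ₗ[ℂ] (Y × X × W)).codRestrict _ hdom) := by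
    constructor
    · rw [injective_iff_map_eq_zero]
      rintro ⟨f, g, w⟩ hp
      have h1 : (P (g, w), ι (f + μ • P (g, w)), w) = 0 := congrArg Subtype.val hp
      rw [Prod.mk_eq_zero, Prod.mk_eq_zero] at h1
      obtain ⟨h1, h2, rfl⟩ := h1
      rw [h1, smul_zero, add_zero] at h2
      have h3 : s.symm (g, 0) = 0 := Subtype.ext h1
      rw [LinearEquiv.map_eq_zero_iff] at h3
      rw [h3, hι (h2.trans (map_zero ι).symm)]
      rfl
    · rintro ⟨⟨u, x, w⟩, ⟨hu, hw⟩, y, hy⟩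
      have hy' : ι y = x := hy
      have hw' : R ⟨u, hu⟩ = w := hw
      -- The coordinates are recovered as `f = v - μ u` and `(g, w) = ((A - l) u, R u)`; the
      -- boundary condition `R u = w` makes the third components agree.
      refine ⟨(y - μ • u, s ⟨u, hu⟩), Subtype.ext ?_⟩
      change V (y - μ • u, s ⟨u, hu⟩) = _
      rw [hV]
      simp only [hPs, LinearEquiv.symm_apply_apply, sub_add_cancel, hy']
      rw [← hw']
      rfl
  refine ⟨LinearEquiv.ofBijective _ hbij, K, hKc, LinearMap.ext fun p => ?_⟩
  exact ((LinearPMap.image_iff (hdom p)).2 (hgraph p)).symm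

end LinearPMap

theorem proposition4p1
    {X Y W Z : Type*}
    [NormedAddCommGroup X] [NormedSpace ℂ X] [CompleteSpace X]
    [NormedAddCommGroup Y] [NormedSpace ℂ Y] [CompleteSpace Y]
    [NormedAddCommGroup W] [NormedSpace ℂ W] [CompleteSpace W]
    [NormedAddCommGroup Z] [NormedSpace ℂ Z] [CompleteSpace Z]
    -- the continuous embedding of `Y` in `X`; the boundary space `∂X` is called `W`
    (ι : Y →L[ℂ] X) (hι : Function.Injective ι)
    -- the operator `A : D(A) → X` with `D(A) ⊆ Y`, and the boundary operators
    (A : Y →ₗ.[ℂ] X)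
    (R : A.domain →ₗ[ℂ] W) (hR : Function.Surjective R)
    (B₁ B₂ : Y →L[ℂ] W) (B₄ : W →L[ℂ] W)
    (hclosed : (stackedOperator A R).IsClosed)
    (hcos : GeneratesCosineWithPhaseSpace ι hι (restrictKer A R))
    -- `Z` is compactly embedded in `Y` and contains `D(A)`
    (j : Z →L[ℂ] Y) (hj : Function.Injective j) (hjc : IsCompactOperator j)
    (hZ : A.domain ≤ LinearMap.range (j : Z →ₗ[ℂ] Y))
    -- the embedding of `Y` in `X` is compact
    (hιc : IsCompactOperator ι) :
    essentialSpectrum (acousticMatrix ι hι A R B₁ B₂ B₄) =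
        essentialSpectrum (boundedOperator B₄) ∧
      (∀ μ : ℂ, μ ∉ essentialSpectrum (boundedOperator B₄) →
        fredholmIndex (subScalar (acousticMatrix ι hι A R B₁ B₂ B₄) μ) =
          fredholmIndex (subScalar (boundedOperator B₄) μ)) ∧
      (essentialSpectrum (acousticMatrix ι hι A R B₁ B₂ B₄) = ∅ ↔ FiniteDimensional ℂ W) := by

  obtain ⟨l, hl⟩ := exists_bijective_shiftedStack ι hι A R hR hcos.2
  have hP := isCompactOperator_subtype_shiftedStack_symm ι A R hclosed j hj hjc hZ l hl
  have key : ∀ μ : ℂ, (IsFredholmOperator (subScalar (acousticMatrix ι hι A R B₁ B₂ B₄) μ) ↔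
      IsFredholmOperator (subScalar (boundedOperator B₄) μ)) ∧
      (IsFredholmOperator (subScalar (boundedOperator B₄) μ) →
        fredholmIndex (subScalar (acousticMatrix ι hι A R B₁ B₂ B₄) μ) =
          fredholmIndex (subScalar (boundedOperator B₄) μ)) := by
    intro μ
    obtain ⟨e, K, hK, he⟩ := exists_equiv_subScalar_acousticMatrix_comp_eq ι hι A R B₁ B₂ B₄ μ
      hιc l hl hP
    have hprod : (((ContinuousLinearMap.id ℂ Y).prodMap ((ContinuousLinearMap.id ℂ X).prodMap
        (B₄ - μ • 1)) : (Y × X × W) →L[ℂ] (Y × X × W)) : _ →ₗ[ℂ] _) =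
        (LinearMap.id : Y →ₗ[ℂ] Y).prodMap ((LinearMap.id : X →ₗ[ℂ] X).prodMap
          ((B₄ - μ • 1 : W →L[ℂ] W) : W →ₗ[ℂ] W)) := rfl
    -- Closedness reduces both sides to linear algebra; then pass to the coordinates `e`, discard
    -- `K`, and strip the two identity blocks.
    rw [isFredholmOperator_iff (isClosed_subScalar_acousticMatrix ι hι A R B₁ B₂ B₄ μ hclosed),
      isFredholmOperator_subScalar_boundedOperator_iff, fredholmIndex_eq_index,
      fredholmIndex_subScalar_boundedOperator, ← hasFiniteKerCoker_comp_equiv_iff _ e,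
      ← index_comp_equiv _ e, he, hasFiniteKerCoker_add_iff hK, hprod,
      hasFiniteKerCoker_id_prodMap_iff, hasFiniteKerCoker_id_prodMap_iff]
    refine ⟨Iff.rfl, fun h => ?_⟩
    rw [← hasFiniteKerCoker_id_prodMap_iff (V := X), ← hasFiniteKerCoker_id_prodMap_iff (V := Y),
      ← hprod] at h
    rw [(h.add_isCompactOperator hK).2, hprod, index_id_prodMap, index_id_prodMap]
  have hess : essentialSpectrum (acousticMatrix ι hι A R B₁ B₂ B₄) =
      essentialSpectrum (boundedOperator B₄) :=
    Set.ext fun μ => not_congr (key μ).1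
  exact ⟨hess, fun μ hμ => (key μ).2 (not_not.1 hμ), by
    rw [hess, essentialSpectrum_boundedOperator_eq_empty_iff]⟩
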